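/- Let $G$ be a real Banach--Lie group, i.e. a group that is also a real-analytic manifold modelled on a real Banach space, with analytic multiplication and inversion. Let $H$ be a proper closed subgroup of $G$ (not necessarily a Lie subgroup), equipped with the subspace topology. Then the inclusion $H\to G$ is not an epimorphism in the category of Hausdorff topological groups and continuous homomorphisms; that is, there exist a Hausdorff topological group $K$ and two distinct continuous homomorphisms $f,g\colon G\to K$ with $f|_H=g|_H$. -/

import Mathlib

open CategoryTheory
open scoped Manifold ContDiff

universe u v

/-- Objects of the category of Hausdorff topological groups. -/
structure HausTopGrp : Type (u + 1) where
  /-- The underlying type. -/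
  carrier : Type u
  [group : Group carrier]
  [topologicalSpace : TopologicalSpace carrier]
  [isTopologicalGroup : IsTopologicalGroup carrier]
  [t2Space : T2Space carrier]

namespace HausTopGrp

instance : CoeSort HausTopGrp.{u} (Type u) where
  coe G := G.carrier

attribute [instance] HausTopGrp.group HausTopGrp.topologicalSpace
  HausTopGrp.isTopologicalGroup HausTopGrp.t2Space

/-- A Hausdorff topological group as an object of the category. -/
abbrev of (G : Type u) [Group G] [TopologicalSpace G] [IsTopologicalGroup G] [T2Space G] :
    HausTopGrp.{u} where
  carrier := G

/-- Morphisms of Hausdorff topological groups are the continuous homomorphisms. -/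
@[ext]
structure Hom (A B : HausTopGrp.{u}) where
  /-- The underlying continuous homomorphism. -/
  hom : A →ₜ* B

instance : Category HausTopGrp.{u} where
  Hom A B := Hom A B
  id A := ⟨ContinuousMonoidHom.id A⟩
  comp f g := ⟨g.hom.comp f.hom⟩

/-- The inclusion of a subgroup, with the subspace topology, into a Hausdorff topological
group. -/
def inclusion (G : HausTopGrp.{u}) (H : Subgroup G) : of H ⟶ G :=
  ⟨{ H.subtype with continuous_toFun := continuous_subtype_val }⟩

end HausTopGrp

/-- A Banach–Lie group is a Hausdorff space: a locally `T₁` space is `T₁`, and a `T₁` topological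
group is Hausdorff. -/
theorem t2Space_of_lieGroup (E : Type v) [NormedAddCommGroup E] [NormedSpace ℝ E]
    (G : Type u) [Group G] [TopologicalSpace G] [ChartedSpace E G]
    [LieGroup 𝓘(ℝ, E) ω G] : T2Space G := by
  have : IsTopologicalGroup G := topologicalGroup_of_lieGroup 𝓘(ℝ, E) ω
  have : T1Space G := ChartedSpace.t1Space E G
  infer_instance

/-- The Hausdorff topological group underlying a real Lie group `G` (an analytic manifold modelled
on the Banach space `E`, with analytic group operations). -/
abbrev HausTopGrp.ofBanachLieGroup (E : Type v) [NormedAddCommGroup E] [NormedSpace ℝ E]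
    (G : Type u) [Group G] [TopologicalSpace G] [ChartedSpace E G]
    [LieGroup 𝓘(ℝ, E) ω G] : HausTopGrp.{u} :=
  haveI : IsTopologicalGroup G := topologicalGroup_of_lieGroup 𝓘(ℝ, E) ω
  haveI : T2Space G := t2Space_of_lieGroup E G
  HausTopGrp.of G

/-!
If `G` acts continuously by automorphisms on a topological group `N`, and some `n : N` is fixed by
`H` but not by all of `G`, then in `N ⋊ G` the inclusion of `G` and its conjugate by `n` are two
homomorphisms that agree on `H` and differ; so `H → G` is not an epimorphism
(`not_epi_inclusion_of_smul`). Here `N` may fail to be Hausdorff as long as "fixed" is read up to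
topological indistinguishability.

Such an `N` is the space of finitely supported measures on `G ⧸ H`, on which `G` acts by
translation; the point mass at the coset `H` is fixed by exactly `H`. It needs a topology that makes
this action continuous. A chart at `1` gives a function `ν`, the truncated distance to `1`, and `N`
is seminormed by duality with the functions `f` on `G ⧸ H` such that `|f| ≤ 1` and
`|f (u x) - f x| ≤ ν u` for all `u` and `x`. Three estimates make this work:

* `‖g • δ_x - δ_x‖ ≤ ν g`, so orbits are continuous;
* left translation by `g` turns the Lipschitz condition for `u` into that for `g u g⁻¹`, so `g` acts
  with norm at most `max 1 C` if `ν (g u g⁻¹) ≤ C ν u` for all `u`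
  (`LipschitzFree.norm_smul_le`);
* `x ↦ inf_{h ∈ H} ν (x h)` is a multiple of a test function, which, as `H` is closed, separates the
  coset `H` from any other (`IsLipschitzGauge.exists_testFunction_ne`).

The properties of `ν` that are used are collected in `IsLipschitzGauge`. In a Lie group they hold
because multiplication and conjugation are `C¹`, hence locally Lipschitz in charts
(`exists_isLipschitzGauge`); truncation takes care of the points far from `1`.
-/

open Topology Filter

/-! ### Semidirect products and the failure of being an epimorphism -/

section SemidirectProduct

variable {G N : Type u} [Group G] [TopologicalSpace G] [Group N] [TopologicalSpace N]
  [MulDistribMulAction G N]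

/-- The semidirect product `N ⋊ G` of a group acted upon by `G`, with the product topology. -/
abbrev ActionSemidirect (G N : Type u) [Group G] [Group N] [MulDistribMulAction G N] : Type u :=
  N ⋊[MulDistribMulAction.toMulAut G N] G

instance : TopologicalSpace (ActionSemidirect G N) :=
  TopologicalSpace.induced SemidirectProduct.equivProd inferInstance

theorem ActionSemidirect.isInducing_equivProd :
    IsInducing (SemidirectProduct.equivProd : ActionSemidirect G N ≃ N × G) :=
  ⟨rfl⟩

instance [IsTopologicalGroup G] [IsTopologicalGroup N] [ContinuousSMul G N] :
    IsTopologicalGroup (ActionSemidirect G N) := by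
  have hl : Continuous fun x : ActionSemidirect G N => x.left :=
    continuous_fst.comp ActionSemidirect.isInducing_equivProd.continuous
  have hr : Continuous fun x : ActionSemidirect G N => x.right :=
    continuous_snd.comp ActionSemidirect.isInducing_equivProd.continuous
  refine { continuous_mul := ?_, continuous_inv := ?_ }
  · refine ActionSemidirect.isInducing_equivProd.continuous_iff.2 (Continuous.prodMk ?_ ?_)
    · exact (hl.comp continuous_fst).mul
        ((hr.comp continuous_fst).smul (hl.comp continuous_snd))
    · exact (hr.comp continuous_fst).mul (hr.comp continuous_snd)
  · refine ActionSemidirect.isInducing_equivProd.continuous_iff.2 (Continuous.prodMk ?_ ?_)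
    · exact hr.inv.smul hl.inv
    · exact hr.inv

/-- If `G` acts continuously by automorphisms on a topological group `N` and some `n : N` is fixed
by `H` but not by `G`, both up to topological indistinguishability, then `H → G` is not an
epimorphism: in the Hausdorff quotient of `N ⋊ G`, the inclusion of `G` and its conjugate by `n`
agree on `H` only. -/
theorem not_epi_inclusion_of_smul [IsTopologicalGroup G] [T2Space G] [IsTopologicalGroup N]
    [ContinuousSMul G N] (H : Subgroup G) (n : N) (hH : ∀ h ∈ H, Inseparable (h • n) n)
    (g : G) (hg : ¬ Inseparable (g • n) n) :
    ¬ Epi ((HausTopGrp.of G).inclusion H) := by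
  intro hepi
  have hinr : Continuous (SemidirectProduct.inr : G →* ActionSemidirect G N) :=
    ActionSemidirect.isInducing_equivProd.continuous_iff.2
      (continuous_const.prodMk continuous_id)
  let K := HausTopGrp.of (SeparationQuotient (ActionSemidirect G N))
  let a : ActionSemidirect G N := SemidirectProduct.inl n
  let f₁ : HausTopGrp.of G ⟶ K :=
    ⟨{ SeparationQuotient.mkMonoidHom.comp SemidirectProduct.inr with
        continuous_toFun := SeparationQuotient.continuous_mk.comp hinr }⟩
  let f₂ : HausTopGrp.of G ⟶ K :=
    ⟨{ SeparationQuotient.mkMonoidHom.comp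
          ((MulAut.conj a).toMonoidHom.comp SemidirectProduct.inr) with
        continuous_toFun := SeparationQuotient.continuous_mk.comp
          ((continuous_const.mul hinr).mul continuous_const) }⟩
  have key (x : G) : f₁.hom x = f₂.hom x ↔ Inseparable (x • n) n := by
    have h₁ : f₁.hom x = f₂.hom x ↔
        Inseparable (SemidirectProduct.inr x : ActionSemidirect G N)
          (a * SemidirectProduct.inr x * a⁻¹) := SeparationQuotient.mk_eq_mk
    rw [h₁, ← ActionSemidirect.isInducing_equivProd.inseparable_iff, inseparable_prod]
    have hl : (a * SemidirectProduct.inr x * a⁻¹ : ActionSemidirect G N).left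
        = n * (x • n)⁻¹ := by
      simp [a]
    have hr : (a * SemidirectProduct.inr x * a⁻¹ : ActionSemidirect G N).right = x := by
      simp [a]
    change Inseparable (1 : N) (a * SemidirectProduct.inr x * a⁻¹ : ActionSemidirect G N).left ∧
      Inseparable x (a * SemidirectProduct.inr x * a⁻¹ : ActionSemidirect G N).right ↔ _
    rw [hl, hr]
    constructor
    · rintro ⟨h, -⟩
      simpa using h.mul (Inseparable.refl (x • n))
    · intro h
      refine ⟨?_, .refl x⟩
      simpa using h.mul (Inseparable.refl (x • n)⁻¹)
  have hcomp : (HausTopGrp.of G).inclusion H ≫ f₁ = (HausTopGrp.of G).inclusion H ≫ f₂ :=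
    HausTopGrp.Hom.ext (ContinuousMonoidHom.ext fun h => (key h.1).2 (hH h.1 h.2))
  have heq : f₁ = f₂ := (cancel_epi _).1 hcomp
  exact hg ((key g).1 (by rw [heq]))

end SemidirectProduct

/-! ### Gauges and their Lipschitz-free modules -/

section Gauge

variable {G : Type u} [Group G]

/-- A gauge on a topological group: a function `ν : G → [0, 1]`, thought of as the distance to `1`,
which defines the neighbourhoods of `1`, which satisfies a Lipschitz form of the triangle
inequality, and which every inner automorphism distorts by a bounded factor. The factor need only
be uniform for conjugation by elements near `1`. -/
structure IsLipschitzGauge [TopologicalSpace G] (ν : G → ℝ) : Prop where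
  nonneg (x : G) : 0 ≤ ν x
  le_one (x : G) : ν x ≤ 1
  tendsto_one : Tendsto ν (𝓝 1) (𝓝 0)
  exists_lt_imp_mem (W : Set G) (hW : W ∈ 𝓝 1) : ∃ δ > 0, ∀ x, ν x < δ → x ∈ W
  conj_le (g : G) : ∃ C, ∀ u, ν (g * u * g⁻¹) ≤ C * ν u
  eventually_conj_le : ∃ C, ∀ᶠ g in 𝓝 (1 : G), ∀ u, ν (g * u * g⁻¹) ≤ C * ν u
  abs_mul_sub_le : ∃ C, ∀ u x, |ν (u * x) - ν x| ≤ C * ν u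

/-- The functions on `G ⧸ H`, written as right `H`-invariant functions on `G`, that are bounded by
`1` and `1`-Lipschitz for left translations measured by `ν`. -/
def lipschitzTestFunctions (ν : G → ℝ) (H : Subgroup G) : Set (G → ℝ) :=
  {f | (∀ x, |f x| ≤ 1) ∧ (∀ x, ∀ h ∈ H, f (x * h) = f x) ∧ ∀ u x, |f (u * x) - f x| ≤ ν u}

/-- The space of finitely supported signed measures on `G`, to be seminormed by duality with
`lipschitzTestFunctions ν H`. Up to indistinguishability these are measures on `G ⧸ H`. -/
def LipschitzFree (_ν : G → ℝ) (_H : Subgroup G) : Type u := G →₀ ℝ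

namespace LipschitzFree

variable {ν : G → ℝ} {H : Subgroup G}

noncomputable instance : AddCommGroup (LipschitzFree ν H) :=
  inferInstanceAs (AddCommGroup (G →₀ ℝ))

/-- The measure of mass `c` concentrated at `x`. -/
noncomputable def single (ν : G → ℝ) (H : Subgroup G) (x : G) (c : ℝ) : LipschitzFree ν H :=
  Finsupp.single x c

/-- Integration of a function against a finitely supported measure. -/
noncomputable def integral (f : G → ℝ) : LipschitzFree ν H →+ ℝ :=
  (Finsupp.linearCombination ℝ f).toAddMonoidHom

theorem integral_single (f : G → ℝ) (x : G) (c : ℝ) : integral f (single ν H x c) = c * f x :=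
  Finsupp.linearCombination_single ℝ c x

theorem integral_apply (f : G → ℝ) (v : LipschitzFree ν H) :
    integral f v = Finsupp.sum (show G →₀ ℝ from v) fun x c => c * f x :=
  Finsupp.linearCombination_apply ℝ _

theorem integral_const_mul (c : ℝ) (f : G → ℝ) (v : LipschitzFree ν H) :
    integral (fun x => c * f x) v = c * integral f v := by
  rw [integral_apply, integral_apply, Finsupp.mul_sum]
  exact Finset.sum_congr rfl fun _ _ => mul_left_comm _ _ _

theorem bddAbove_integral (v : LipschitzFree ν H) :
    BddAbove (Set.range fun f : lipschitzTestFunctions ν H => |integral (f : G → ℝ) v|) := by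
  refine ⟨Finsupp.sum (show G →₀ ℝ from v) fun _ c => |c|, ?_⟩
  rintro _ ⟨f, rfl⟩
  simp only [integral_apply]
  refine (Finset.abs_sum_le_sum_abs _ _).trans (Finset.sum_le_sum fun x _ => ?_)
  rw [abs_mul]
  exact mul_le_of_le_one_right (abs_nonneg _) (f.2.1 x)

/-- The seminorm dual to the test functions. -/
noncomputable def addGroupSeminorm (ν : G → ℝ) (H : Subgroup G) :
    AddGroupSeminorm (LipschitzFree ν H) where
  toFun v := ⨆ f : lipschitzTestFunctions ν H, |integral (f : G → ℝ) v|
  map_zero' := by simp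
  add_le' v w := by
    refine Real.iSup_le (fun f => ?_) (add_nonneg (Real.iSup_nonneg fun _ => abs_nonneg _)
      (Real.iSup_nonneg fun _ => abs_nonneg _))
    rw [map_add]
    exact (abs_add_le _ _).trans
      (add_le_add (le_ciSup (bddAbove_integral v) f) (le_ciSup (bddAbove_integral w) f))
  neg' v := by simp

noncomputable instance : SeminormedAddCommGroup (LipschitzFree ν H) :=
  (addGroupSeminorm ν H).toSeminormedAddCommGroup

theorem abs_integral_le (v : LipschitzFree ν H) {f : G → ℝ}
    (hf : f ∈ lipschitzTestFunctions ν H) : |integral f v| ≤ ‖v‖ :=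
  le_ciSup (bddAbove_integral v) ⟨f, hf⟩

theorem norm_le (v : LipschitzFree ν H) {r : ℝ} (hr : 0 ≤ r)
    (h : ∀ f ∈ lipschitzTestFunctions ν H, |integral f v| ≤ r) : ‖v‖ ≤ r :=
  Real.iSup_le (fun f => h f.1 f.2) hr

noncomputable instance : DistribMulAction G (LipschitzFree ν H) where
  smul g v := Finsupp.mapDomain (g * ·) (show G →₀ ℝ from v)
  one_smul v := by
    change Finsupp.mapDomain _ _ = _
    simp only [one_mul]
    exact Finsupp.mapDomain_id
  mul_smul a b v := by
    change Finsupp.mapDomain _ _ = Finsupp.mapDomain _ (Finsupp.mapDomain _ _)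
    rw [← Finsupp.mapDomain_comp]
    simp only [Function.comp_def, mul_assoc]
  smul_zero _ := Finsupp.mapDomain_zero
  smul_add _ _ _ := Finsupp.mapDomain_add

theorem integral_smul (f : G → ℝ) (g : G) (v : LipschitzFree ν H) :
    integral f (g • v) = integral (fun x => f (g * x)) v :=
  Finsupp.linearCombination_mapDomain ℝ _ _

theorem smul_single (g x : G) (c : ℝ) : g • single ν H x c = single ν H (g * x) c :=
  Finsupp.mapDomain_single

@[elab_as_elim]
theorem induction_single {p : LipschitzFree ν H → Prop}
    (add : ∀ v w, p v → p w → p (v + w)) (zero : p 0)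
    (single : ∀ x c, p (single ν H x c)) (v) : p v :=
  Finsupp.induction_linear (motive := p) v zero (fun v w => add v w) single

/-- Left translation by `g` changes the Lipschitz constant of a test function at most by the factor
by which conjugation by `g` distorts the gauge. -/
theorem norm_smul_le (hν : ∀ x, 0 ≤ ν x) {g : G} {C : ℝ} (hC : ∀ u, ν (g * u * g⁻¹) ≤ C * ν u)
    (v : LipschitzFree ν H) : ‖g • v‖ ≤ max 1 C * ‖v‖ := by
  have hD : 0 < max 1 C := lt_max_of_lt_left one_pos
  refine norm_le _ (mul_nonneg hD.le (norm_nonneg _)) fun f hf => ?_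
  have hmem : (fun x => (max 1 C)⁻¹ * f (g * x)) ∈ lipschitzTestFunctions ν H := by
    refine ⟨fun x => ?_, fun x h hh => ?_, fun u x => ?_⟩
    · rw [abs_mul, abs_of_pos (inv_pos.2 hD)]
      exact mul_le_one₀ (inv_le_one_of_one_le₀ (le_max_left _ _)) (abs_nonneg _) (hf.1 _)
    · simp only [← mul_assoc g x h, hf.2.1 _ h hh]
    · rw [← mul_sub, abs_mul, abs_of_pos (inv_pos.2 hD), inv_mul_le_iff₀ hD]
      have h := hf.2.2 (g * u * g⁻¹) (g * x)
      rw [show g * u * g⁻¹ * (g * x) = g * (u * x) by group] at h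
      exact h.trans ((hC u).trans (mul_le_mul_of_nonneg_right (le_max_right _ _) (hν u)))
  have h := abs_integral_le v hmem
  rwa [integral_const_mul, abs_mul, abs_of_pos (inv_pos.2 hD), inv_mul_le_iff₀ hD,
    ← integral_smul] at h

theorem norm_smul_single_sub_le (hν : ∀ x, 0 ≤ ν x) (g x : G) (c : ℝ) :
    ‖g • single ν H x c - single ν H x c‖ ≤ |c| * ν g := by
  refine norm_le _ (mul_nonneg (abs_nonneg _) (hν g)) fun f hf => ?_
  rw [smul_single, map_sub, integral_single, integral_single, ← mul_sub, abs_mul]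
  exact mul_le_mul_of_nonneg_left (hf.2.2 g x) (abs_nonneg c)

variable [TopologicalSpace G]

theorem tendsto_norm_smul_sub (hν : IsLipschitzGauge ν) (v : LipschitzFree ν H) :
    Tendsto (fun g : G => ‖g • v - v‖) (𝓝 1) (𝓝 0) := by
  induction v using induction_single with
  | zero => simp
  | add v w hv hw =>
    refine squeeze_zero (fun _ => norm_nonneg _) (fun g => ?_) (by simpa using hv.add hw)
    rw [smul_add, add_sub_add_comm]
    exact norm_add_le _ _
  | single x c =>
    exact squeeze_zero (fun _ => norm_nonneg _) (fun g => norm_smul_single_sub_le hν.nonneg g x c)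
      (by simpa using hν.tendsto_one.const_mul |c|)

theorem continuousSMul [IsTopologicalGroup G] (hν : IsLipschitzGauge ν) :
    ContinuousSMul G (LipschitzFree ν H) := by
  refine ⟨continuous_iff_continuousAt.2 fun ⟨g₀, v₀⟩ => ?_⟩
  obtain ⟨C₀, hC₀⟩ := hν.conj_le g₀
  obtain ⟨C, hC⟩ := hν.eventually_conj_le
  have hk : Tendsto (fun p : G × LipschitzFree ν H => g₀⁻¹ * p.1) (𝓝 (g₀, v₀)) (𝓝 1) := by
    have : Continuous fun p : G × LipschitzFree ν H => g₀⁻¹ * p.1 := by fun_prop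
    simpa using this.tendsto (g₀, v₀)
  have hv : Tendsto (fun p : G × LipschitzFree ν H => ‖p.2 - v₀‖) (𝓝 (g₀, v₀)) (𝓝 0) := by
    have : Continuous fun p : G × LipschitzFree ν H => ‖p.2 - v₀‖ := by fun_prop
    simpa using this.tendsto (g₀, v₀)
  have hlim := ((hv.const_mul (max 1 C)).add
    ((tendsto_norm_smul_sub hν v₀).comp hk)).const_mul (max 1 C₀)
  simp only [mul_zero, add_zero] at hlim
  refine tendsto_iff_norm_sub_tendsto_zero.2
    (squeeze_zero' (Eventually.of_forall fun _ => norm_nonneg _) ?_ hlim)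
  filter_upwards [hk.eventually hC] with p hp
  -- With `k = g₀⁻¹ g` close to `1`, split `g v - g₀ v₀ = g₀ (k (v - v₀) + (k v₀ - v₀))`.
  have hsplit : p.1 • p.2 - g₀ • v₀
      = g₀ • ((g₀⁻¹ * p.1) • (p.2 - v₀) + ((g₀⁻¹ * p.1) • v₀ - v₀)) := by
    simp [smul_sub, smul_smul]
  change ‖p.1 • p.2 - g₀ • v₀‖ ≤ _
  rw [hsplit]
  refine (norm_smul_le hν.nonneg hC₀ _).trans (mul_le_mul_of_nonneg_left ?_
    (zero_le_one.trans (le_max_left _ _)))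
  exact (norm_add_le _ _).trans (add_le_add (norm_smul_le hν.nonneg hp _) le_rfl)

noncomputable instance : MulDistribMulAction G (Multiplicative (LipschitzFree ν H)) where
  smul g v := Multiplicative.ofAdd (g • v.toAdd)
  one_smul v := congrArg Multiplicative.ofAdd (one_smul G v.toAdd)
  mul_smul a b v := congrArg Multiplicative.ofAdd (mul_smul a b v.toAdd)
  smul_one a := congrArg Multiplicative.ofAdd (smul_zero a)
  smul_mul a v w := congrArg Multiplicative.ofAdd (smul_add a v.toAdd w.toAdd)

end LipschitzFree

/-- The distance to `H` measured by the gauge, `x ↦ inf_{h ∈ H} ν (x h)`, is up to scaling a test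
function that separates `H` from any point outside the closed subgroup `H`. -/
theorem IsLipschitzGauge.exists_testFunction_ne [TopologicalSpace G] [IsTopologicalGroup G]
    {ν : G → ℝ} (hν : IsLipschitzGauge ν) {H : Subgroup G} (hH : IsClosed (H : Set G)) {g : G}
    (hg : g ∉ H) : ∃ f ∈ lipschitzTestFunctions ν H, f g ≠ f 1 := by
  obtain ⟨C, hC⟩ := hν.abs_mul_sub_le
  have hD : 0 < max 1 C := lt_max_of_lt_left one_pos
  let d : G → ℝ := fun x => ⨅ h : H, ν (x * h)
  have hbdd (x : G) : BddBelow (Set.range fun h : H => ν (x * h)) :=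
    ⟨0, by rintro _ ⟨h, rfl⟩; exact hν.nonneg _⟩
  have hd_nonneg (x : G) : 0 ≤ d x := le_ciInf fun h => hν.nonneg _
  have hd_le (x : G) : d x ≤ 1 := (ciInf_le (hbdd x) 1).trans (hν.le_one _)
  have hd_lip (u x : G) : |d (u * x) - d x| ≤ C * ν u := by
    rw [abs_sub_le_iff]
    constructor
    · rw [sub_le_comm]
      refine le_ciInf fun h => ?_
      have h₁ := ciInf_le (hbdd (u * x)) h
      have h₂ := (abs_le.1 (hC u (x * h))).2
      rw [← mul_assoc] at h₂
      change (⨅ h : H, ν (u * x * h)) - _ ≤ _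
      linarith
    · rw [sub_le_comm]
      refine le_ciInf fun h => ?_
      have h₁ := ciInf_le (hbdd x) h
      have h₂ := (abs_le.1 (hC u (x * h))).1
      rw [← mul_assoc] at h₂
      change (⨅ h : H, ν (x * h)) - _ ≤ _
      linarith
  have hd_inv (x : G) (h : G) (hh : h ∈ H) : d (x * h) = d x := by
    refine (Equiv.mulLeft (⟨h, hh⟩ : H)).iInf_congr fun k => ?_
    simp [mul_assoc]
  have hd_one : d 1 = 0 := by
    refine le_antisymm ((ciInf_le (hbdd 1) 1).trans ?_) (hd_nonneg 1)
    have h₀ : ν 1 = 0 :=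
      tendsto_nhds_unique (tendsto_pure_nhds ν 1) (hν.tendsto_one.mono_left (pure_le_nhds 1))
    simp [h₀]
  have hd_g : 0 < d g := by
    have hW : {x : G | g⁻¹ * x ∉ H} ∈ 𝓝 1 :=
      (hH.isOpen_compl.preimage (continuous_const_mul g⁻¹)).mem_nhds (by simpa using hg)
    obtain ⟨δ, hδ, hlt⟩ := hν.exists_lt_imp_mem _ hW
    refine hδ.trans_le (le_ciInf fun h => le_of_not_gt fun hlt' => ?_)
    exact hlt _ hlt' (by simp)
  refine ⟨fun x => (max 1 C)⁻¹ * d x, ⟨fun x => ?_, fun x h hh => ?_, fun u x => ?_⟩, ?_⟩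
  · rw [abs_mul, abs_of_pos (inv_pos.2 hD), abs_of_nonneg (hd_nonneg x)]
    exact mul_le_one₀ (inv_le_one_of_one_le₀ (le_max_left _ _)) (hd_nonneg x) (hd_le x)
  · simp only [hd_inv x h hh]
  · rw [← mul_sub, abs_mul, abs_of_pos (inv_pos.2 hD), inv_mul_le_iff₀ hD]
    exact (hd_lip u x).trans (mul_le_mul_of_nonneg_right (le_max_right _ _) (hν.nonneg u))
  · simp only [hd_one, mul_zero]
    exact (mul_pos (inv_pos.2 hD) hd_g).ne'

open LipschitzFree in
/-- A proper closed subgroup of a group with a gauge fixes the point mass at `1`, up to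
indistinguishability, and no element outside it does. -/
theorem IsLipschitzGauge.not_epi_inclusion [TopologicalSpace G] [IsTopologicalGroup G] [T2Space G]
    {ν : G → ℝ} (hν : IsLipschitzGauge ν) {H : Subgroup G} (hH : IsClosed (H : Set G))
    (hproper : H ≠ ⊤) : ¬ Epi ((HausTopGrp.of G).inclusion H) := by
  obtain ⟨g, hg⟩ := not_forall.1 fun h => hproper ((Subgroup.eq_top_iff' H).2 h)
  obtain ⟨f, hf, hfg⟩ := hν.exists_testFunction_ne hH hg
  have := continuousSMul (H := H) hν
  have : ContinuousSMul G (Multiplicative (LipschitzFree ν H)) :=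
    ⟨(continuous_smul : Continuous fun p : G × LipschitzFree ν H => p.1 • p.2)⟩
  refine not_epi_inclusion_of_smul H (Multiplicative.ofAdd (single ν H 1 1)) (fun h hh => ?_) g
    fun hins => hfg ?_
  · change Inseparable (h • single ν H 1 1) (single ν H 1 1)
    rw [Metric.inseparable_iff, dist_eq_norm]
    refine le_antisymm (norm_le _ le_rfl fun f hf => ?_) (norm_nonneg _)
    have := hf.2.1 1 h hh
    rw [one_mul] at this
    simp [smul_single, integral_single, this]
  · change Inseparable (g • single ν H 1 1) (single ν H 1 1) at hins
    rw [Metric.inseparable_iff, dist_eq_norm] at hins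
    have h := abs_integral_le (g • single ν H 1 1 - single ν H 1 1) hf
    rw [hins, smul_single, map_sub, integral_single, integral_single, one_mul, one_mul, mul_one] at h
    exact sub_eq_zero.1 (abs_nonpos_iff.1 h)

end Gauge

/-! ### The gauge of a Lie group given by a chart at the identity -/

section ChartGauge

variable {E : Type v} [NormedAddCommGroup E] [NormedSpace ℝ E]
  {G : Type u} [Group G] [TopologicalSpace G] [ChartedSpace E G]

variable (E) in
/-- The distance from `1` to `x` in the chart at `1`. It is meaningful only for `x` in the chart
domain. -/
noncomputable def chartDist (x : G) : ℝ :=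
  ‖extChartAt 𝓘(ℝ, E) (1 : G) x - extChartAt 𝓘(ℝ, E) (1 : G) 1‖

open Classical in
variable (E) in
/-- The distance to `1` in the chart at `1`, truncated at `r`; it is `r` outside the chart
domain. -/
noncomputable def chartGauge (r : ℝ) (x : G) : ℝ :=
  if x ∈ (extChartAt 𝓘(ℝ, E) (1 : G)).source then min r (chartDist E x) else r

theorem chartDist_nonneg (x : G) : 0 ≤ chartDist E x := norm_nonneg _

theorem chartGauge_of_mem {x : G} (hx : x ∈ (extChartAt 𝓘(ℝ, E) (1 : G)).source) (r : ℝ) :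
    chartGauge E r x = min r (chartDist E x) := if_pos hx

theorem chartGauge_of_notMem {x : G} (hx : x ∉ (extChartAt 𝓘(ℝ, E) (1 : G)).source) (r : ℝ) :
    chartGauge E r x = r := if_neg hx

theorem chartGauge_le (r : ℝ) (x : G) : chartGauge E r x ≤ r := by
  unfold chartGauge
  split_ifs
  exacts [min_le_left _ _, le_rfl]

theorem chartGauge_nonneg {r : ℝ} (hr : 0 ≤ r) (x : G) : 0 ≤ chartGauge E r x := by
  unfold chartGauge
  split_ifs
  exacts [le_min hr (chartDist_nonneg x), hr]

theorem mem_source_of_chartGauge_lt {r : ℝ} {x : G} (hx : chartGauge E r x < r) :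
    x ∈ (extChartAt 𝓘(ℝ, E) (1 : G)).source := by
  by_contra h
  exact hx.ne (chartGauge_of_notMem h r)

theorem tendsto_chartDist : Tendsto (chartDist E : G → ℝ) (𝓝 1) (𝓝 0) :=
  tendsto_iff_norm_sub_tendsto_zero.1 (continuousAt_extChartAt (I := 𝓘(ℝ, E)) (1 : G))

theorem exists_chartDist_lt_imp_mem {W : Set G} (hW : W ∈ 𝓝 1) :
    ∃ δ > 0, ∀ x ∈ (extChartAt 𝓘(ℝ, E) (1 : G)).source, chartDist E x < δ → x ∈ W := by
  have h : (extChartAt 𝓘(ℝ, E) (1 : G)).symm ⁻¹' W ∈ 𝓝 (extChartAt 𝓘(ℝ, E) (1 : G) 1) :=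
    (continuousAt_extChartAt_symm (I := 𝓘(ℝ, E)) (1 : G)).preimage_mem_nhds
      (by rwa [extChartAt_to_inv])
  obtain ⟨δ, hδ, hball⟩ := Metric.mem_nhds_iff.1 h
  refine ⟨δ, hδ, fun x hx hlt => ?_⟩
  have := hball (mem_ball_iff_norm.2 hlt)
  rwa [Set.mem_preimage, PartialEquiv.left_inv _ hx] at this

theorem exists_chartGauge_lt_imp_mem {r : ℝ} (hr : 0 < r) {W : Set G} (hW : W ∈ 𝓝 1) :
    ∃ δ > 0, ∀ x, chartGauge E r x < δ → x ∈ W := by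
  obtain ⟨δ, hδ, h⟩ := exists_chartDist_lt_imp_mem (E := E) hW
  refine ⟨min r δ, lt_min hr hδ, fun x hx => ?_⟩
  have hxs := mem_source_of_chartGauge_lt (hx.trans_le (min_le_left _ _))
  rw [chartGauge_of_mem hxs] at hx
  refine h x hxs (lt_of_not_ge fun hδx => ?_)
  exact absurd hx (not_lt.2 (min_le_min_left r hδx))

/-- A quantity that is at most `r`, and at most `C` times the chart distance of `u` for `u` in a
neighbourhood of `1`, is bounded by a multiple of the truncated gauge of `u` without restriction
on `u`. -/
theorem le_mul_chartGauge {r C δ t : ℝ} (hr : 0 < r) (hδ : 0 < δ) {W : Set G}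
    (hWδ : ∀ x, chartGauge E r x < δ → x ∈ W) (hWs : W ⊆ (extChartAt 𝓘(ℝ, E) (1 : G)).source)
    {u : G} (ht : t ≤ r) (htu : u ∈ W → t ≤ C * chartDist E u) :
    t ≤ max (max 1 C) (r / δ) * chartGauge E r u := by
  have hν := chartGauge_nonneg (E := E) hr.le u
  by_cases hu : u ∈ W
  · refine le_trans ?_ (mul_le_mul_of_nonneg_right (le_max_left _ _) hν)
    rw [chartGauge_of_mem (hWs hu), mul_min_of_nonneg _ _ (zero_le_one.trans (le_max_left 1 C))]
    refine le_min (ht.trans (le_mul_of_one_le_left hr.le (le_max_left _ _))) ?_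
    exact (htu hu).trans (mul_le_mul_of_nonneg_right (le_max_right _ _) (chartDist_nonneg u))
  · refine le_trans ?_ (mul_le_mul_of_nonneg_right (le_max_right _ _) hν)
    have hδu : δ ≤ chartGauge E r u := le_of_not_gt fun h => hu (hWδ u h)
    calc t ≤ r / δ * δ := by rwa [div_mul_cancel₀ _ hδ.ne']
      _ ≤ _ := mul_le_mul_of_nonneg_left hδu (by positivity)

/-- A `C¹` map `F : G × G → G` fixing the identity is, in the chart at `1`, Lipschitz in the second
variable near `1`. -/
theorem exists_chart_lipschitz {F : G × G → G}
    (hF : ContMDiffAt (𝓘(ℝ, E).prod 𝓘(ℝ, E)) 𝓘(ℝ, E) 1 F (1, 1)) (hF₁ : F (1, 1) = 1) :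
    ∃ C : ℝ, 0 ≤ C ∧ ∃ U ∈ 𝓝 (1 : G), ∀ a ∈ U, ∀ b ∈ U,
      F (a, b) ∈ (extChartAt 𝓘(ℝ, E) (1 : G)).source ∧
      ‖extChartAt 𝓘(ℝ, E) (1 : G) (F (a, b)) - extChartAt 𝓘(ℝ, E) (1 : G) (F (a, 1))‖
        ≤ C * chartDist E b := by
  obtain ⟨hcont, hdiff⟩ := contMDiffAt_iff.1 hF
  rw [hF₁, ModelWithCorners.range_eq_univ, contDiffWithinAt_univ] at hdiff
  obtain ⟨K, t, ht, hlip⟩ := hdiff.exists_lipschitzOnWith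
  have h₁ : ∀ᶠ p : G × G in 𝓝 (1, 1), F p ∈ (extChartAt 𝓘(ℝ, E) (1 : G)).source :=
    hcont.eventually (by rw [hF₁]; exact extChartAt_source_mem_nhds 1)
  have h₂ : ∀ᶠ p : G × G in 𝓝 (1, 1),
      extChartAt (𝓘(ℝ, E).prod 𝓘(ℝ, E)) ((1, 1) : G × G) p ∈ t :=
    (continuousAt_extChartAt _).eventually ht
  have h₃ : ∀ᶠ p : G × G in 𝓝 (1, 1),
      p ∈ (extChartAt (𝓘(ℝ, E).prod 𝓘(ℝ, E)) ((1, 1) : G × G)).source :=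
    extChartAt_source_mem_nhds _
  have h := h₁.and (h₂.and h₃)
  rw [nhds_prod_eq] at h
  obtain ⟨U, hU, hUp⟩ := eventually_prod_self_iff'.1 h
  refine ⟨K, K.2, U, hU, fun a ha b hb => ⟨(hUp a ha b hb).1, ?_⟩⟩
  obtain ⟨-, hbt, hbs⟩ := hUp a ha b hb
  obtain ⟨-, h1t, h1s⟩ := hUp a ha 1 (mem_of_mem_nhds hU)
  have := hlip.norm_sub_le hbt h1t
  simp only [Function.comp_apply, PartialEquiv.left_inv _ hbs, PartialEquiv.left_inv _ h1s] at this
  refine this.trans (mul_le_mul_of_nonneg_left ?_ K.2)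
  rw [extChartAt_prod]
  simp [chartDist, Prod.norm_def]

variable (E G) in
/-- Every `C¹` Lie group modelled on a normed space has a gauge. -/
theorem exists_isLipschitzGauge [LieGroup 𝓘(ℝ, E) 1 G] :
    ∃ ν : G → ℝ, IsLipschitzGauge ν := by
  have hfst : ContMDiff (𝓘(ℝ, E).prod 𝓘(ℝ, E)) 𝓘(ℝ, E) 1 (Prod.fst : G × G → G) := contMDiff_fst
  have hsnd : ContMDiff (𝓘(ℝ, E).prod 𝓘(ℝ, E)) 𝓘(ℝ, E) 1 (Prod.snd : G × G → G) := contMDiff_snd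
  obtain ⟨C₁, -, U₁, hU₁, h₁⟩ := exists_chart_lipschitz (E := E)
    (F := fun p : G × G => p.1 * p.2 * p.1⁻¹)
    ((hfst.mul hsnd).mul hfst.inv).contMDiffAt (by simp)
  obtain ⟨C₂, hC₂, U₂, hU₂, h₂⟩ := exists_chart_lipschitz (E := E) (F := fun p : G × G => p.2 * p.1)
    (hsnd.mul hfst).contMDiffAt (by simp)
  obtain ⟨C₃, -, U₃, hU₃, h₃⟩ := exists_chart_lipschitz (E := E) (F := fun p : G × G => p.2⁻¹ * p.1)
    (hsnd.inv.mul hfst).contMDiffAt (by simp)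
  have hsource := extChartAt_source_mem_nhds (I := 𝓘(ℝ, E)) (1 : G)
  obtain ⟨r₀, hr₀, hU⟩ := exists_chartDist_lt_imp_mem (E := E) (inter_mem hU₂ hU₃)
  -- The ball of radius `r` lies in the domain of the Lipschitz estimates, so that two points
  -- outside that domain have the same gauge `r`.
  obtain ⟨r, hr, hr₁, hrr₀⟩ : ∃ r : ℝ, 0 < r ∧ r ≤ 1 ∧ r ≤ r₀ :=
    ⟨min 1 r₀, lt_min one_pos hr₀, min_le_left _ _, min_le_right _ _⟩
  have hrU (x : G) (hx : x ∉ U₂ ∩ U₃) : chartGauge E r x = r := by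
    refine (chartGauge_le r x).antisymm (le_of_not_gt fun hlt => hx ?_)
    have hxs := mem_source_of_chartGauge_lt hlt
    rw [chartGauge_of_mem hxs] at hlt
    exact hU x hxs ((min_lt_iff.1 hlt).resolve_left (lt_irrefl _) |>.trans_le hrr₀)
  have hsub (x y : G) : |chartGauge E r x - chartGauge E r y| ≤ r :=
    abs_sub_le_of_nonneg_of_le (chartGauge_nonneg hr.le x) (chartGauge_le r x)
      (chartGauge_nonneg hr.le y) (chartGauge_le r y)
  have hsub_source {x y : G} (hx : x ∈ (extChartAt 𝓘(ℝ, E) (1 : G)).source)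
      (hy : y ∈ (extChartAt 𝓘(ℝ, E) (1 : G)).source) :
      |chartGauge E r x - chartGauge E r y|
        ≤ ‖extChartAt 𝓘(ℝ, E) (1 : G) x - extChartAt 𝓘(ℝ, E) (1 : G) y‖ := by
    rw [chartGauge_of_mem hx, chartGauge_of_mem hy, min_comm r, min_comm r]
    refine (abs_min_sub_min_le_max _ _ _ _).trans (max_le ?_ (by simp))
    refine (abs_norm_sub_norm_le _ _).trans_eq ?_
    congr 1
    abel
  refine ⟨chartGauge E r, ⟨chartGauge_nonneg hr.le, fun x => (chartGauge_le r x).trans hr₁, ?_,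
    fun W hW => exists_chartGauge_lt_imp_mem hr hW, fun g => ?_, ?_, ?_⟩⟩
  · refine squeeze_zero' (Eventually.of_forall (chartGauge_nonneg hr.le)) ?_
      (tendsto_chartDist (E := E) (G := G))
    filter_upwards [hsource] with x hx
    exact (chartGauge_of_mem hx r).trans_le (min_le_right _ _)
  · have hconst : ContMDiff (𝓘(ℝ, E).prod 𝓘(ℝ, E)) 𝓘(ℝ, E) 1 (fun _ : G × G => g) :=
      contMDiff_const
    obtain ⟨C, -, U, hU, h⟩ := exists_chart_lipschitz (E := E) (F := fun p : G × G => g * p.2 * g⁻¹)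
      ((hconst.mul hsnd).mul hconst.inv).contMDiffAt (by simp)
    obtain ⟨δ, hδ, hW⟩ := exists_chartGauge_lt_imp_mem (E := E) hr (inter_mem hU hsource)
    refine ⟨_, fun u => le_mul_chartGauge hr hδ hW Set.inter_subset_right (C := C)
      (chartGauge_le r _) fun hu => ?_⟩
    obtain ⟨hs, hle⟩ := h 1 (mem_of_mem_nhds hU) u hu.1
    rw [chartGauge_of_mem hs]
    simp only [mul_one, mul_inv_cancel] at hle
    exact (min_le_right _ _).trans hle
  · obtain ⟨δ, hδ, hW⟩ := exists_chartGauge_lt_imp_mem (E := E) hr (inter_mem hU₁ hsource)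
    refine ⟨max (max 1 C₁) (r / δ), ?_⟩
    filter_upwards [hU₁] with g hg u
    refine le_mul_chartGauge hr hδ hW Set.inter_subset_right (C := C₁)
      (chartGauge_le r _) fun hu => ?_
    obtain ⟨hs, hle⟩ := h₁ g hg u hu.1
    rw [chartGauge_of_mem hs]
    simp only [mul_one, mul_inv_cancel] at hle
    exact (min_le_right _ _).trans hle
  · obtain ⟨δ, hδ, hW⟩ := exists_chartGauge_lt_imp_mem (E := E) hr
      (inter_mem (inter_mem hU₂ hU₃) hsource)
    refine ⟨_, fun u x => le_mul_chartGauge hr hδ hW Set.inter_subset_right (C := max C₂ C₃)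
      (hsub _ _) fun hu => ?_⟩
    have hu0 := chartDist_nonneg (E := E) u
    by_cases hx : x ∈ U₂ ∩ U₃
    · obtain ⟨hs, hle⟩ := h₂ x hx.1 u hu.1.1
      have hs' := (h₂ x hx.1 1 (mem_of_mem_nhds hU₂)).1
      simp only [one_mul] at hle hs'
      exact (hsub_source hs hs').trans
        (hle.trans (mul_le_mul_of_nonneg_right (le_max_left _ _) hu0))
    by_cases hux : u * x ∈ U₂ ∩ U₃
    -- Here `x` is recovered from `u * x` by translating with `u⁻¹`.
    · obtain ⟨hs, hle⟩ := h₃ (u * x) hux.2 u hu.1.2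
      have hs' := (h₃ (u * x) hux.2 1 (mem_of_mem_nhds hU₃)).1
      simp only [inv_one, one_mul, inv_mul_cancel_left] at hle hs hs'
      rw [abs_sub_comm]
      exact (hsub_source hs hs').trans
        (hle.trans (mul_le_mul_of_nonneg_right (le_max_right _ _) hu0))
    · rw [hrU _ hx, hrU _ hux, sub_self, abs_zero]
      exact mul_nonneg (hC₂.trans (le_max_left _ _)) hu0

end ChartGauge

theorem theoremt (E : Type v) [NormedAddCommGroup E] [NormedSpace ℝ E] [CompleteSpace E]
    (G : Type u) [Group G] [TopologicalSpace G] [ChartedSpace E G] [LieGroup 𝓘(ℝ, E) ω G]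
    (H : Subgroup G) (hclosed : IsClosed (H : Set G)) (hproper : H ≠ ⊤) :
    ¬ Epi ((HausTopGrp.ofBanachLieGroup E G).inclusion H) := by
  have : IsTopologicalGroup G := topologicalGroup_of_lieGroup 𝓘(ℝ, E) ω
  have : T2Space G := t2Space_of_lieGroup E G
  have : LieGroup 𝓘(ℝ, E) 1 G := LieGroup.of_le (n := ω) le_top
  obtain ⟨ν, hν⟩ := exists_isLipschitzGauge E G
  exact hν.not_epi_inclusion hclosed hproper
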